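/- **Setting.** Consider $n$ qubits, with Pauli strings $\sigma\in\{I,\sigma_X,\sigma_Y,\sigma_Z\}^{\otimes n}$. For a Hermitian $2^n\times 2^n$ matrix $M$ write $M=\frac{\mathrm{Tr}(M)}{2^n}I+\boldsymbol w\cdot\boldsymbol\sigma_n$, where $\boldsymbol\sigma_n$ lists the Pauli strings other than $I^{\otimes n}$; $\boldsymbol w$ is the real vector with entries $\mathrm{Tr}(M\sigma)/2^n$. *Noise.* Let $q_X,q_Y,q_Z\ge 0$ with $q_X+q_Y+q_Z\le 1$, let $\mathcal P(\rho)=\sum_{i\in\{X,Y,Z\}}q_i\sigma_i\rho\sigma_i+(1-\sum_i q_i)\rho$ be the single-qubit Pauli channel, and let $q=\max\{|1-2q_Y-2q_Z|,\,|1-2q_X-2q_Z|,\,|1-2q_X-2q_Y|\}$ be its strength. *Circuit.* For $l\ge 1$ let $U_l(\theta_l)=\exp\{-i\sum_j(\theta_{lj}H_{lj}+R_{lj})\}$ (a finite sum) with Hermitian $H_{lj},R_{lj}$ and real parameters $\theta_{lj}$. Starting from a density matrix $\rho_0$ put $\rho_l=\mathcal P^{\otimes n}\big(U_l(\theta_l)\rho_{l-1}U_l(\theta_l)^\dagger\big)$;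 $\rho_L$ is the output of the noisy circuit of depth $L$. *Costs.* Let $O=\sum_i\lambda_i|i\rangle\langle i|$ be an eigendecomposition of an observable (an orthonormal eigenbasis $|i\rangle$, real $\lambda_i$), let $S$ be a set of indices $i$, identified with the subspace spanned by the $|i\rangle$, $i\in S$, and put $p_i=\langle i|\rho_L|i\rangle$, $O_1=\sum_{i\in S}\lambda_i|i\rangle\langle i|$, $O_2=\sum_{i\in S}|i\rangle\langle i|$, $k_a=\mathrm{Tr}(O_a)/2^n$, $O_a=k_aI+\boldsymbol w_a\cdot\boldsymbol\sigma_n$, $O_a'=O_a-k_aI$ ($a=1,2$). The truncated costs are $$C_1=\frac{\sum_{i\in S}\lambda_ip_i}{\sum_{i\in S}p_i},\qquad C_2=\frac{\mathrm{Tr}(\rho_LO_1')}{\mathrm{Tr}(\rho_LO_2')}.$$ **Theorem 3.1 (Mitigating gradient vanishing).** Let $\epsilon>0$ be small in the sense that $\sqrt2\,\epsilon^2\le q$, and let $L_0$ be the least integer $\ge 0$ with $q^{L_0}\sqrt{2^n-1}\,\|\boldsymbol w_2\|_2(1+\epsilon)\le\left|\frac{\mathrm{Tr}(O_2)}{2^n}\right|$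 (it is assumed to exist). Then for every depth $L>2L_0+1$, every parameter $\theta_{lm}$ with $1\le l\le L$, and every parameter point at which $\mathrm{Tr}(\rho_LO_2')\ne0$ (so that $C_2$ is defined there), $C_1$ and $C_2$ are differentiable in $\theta_{lm}$ and $$\left|\partial_{\theta_{lm}}C_2\right|\ \ge\ \frac{s}{q^{L+1}}\left|\partial_{\theta_{lm}}C_1\right|-1,$$ where $$s=\min\left\{\frac{\epsilon^2k_2^2}{(1+\epsilon)^2\sqrt{2^{n+1}-2}\,N_{lm}\|\boldsymbol\eta_{lm}\|_\infty\|\boldsymbol w_1k_2-\boldsymbol w_2k_1\|_2},\ \left(\frac{|k_2|}{q^{L_0}\sqrt{2^n-1}\,\|\boldsymbol w_2\|_2}-q^{L_0+1}\right)^2\right\},$$ $\boldsymbol\eta_{lm}$ is the vector of coefficients of $H_{lm}=\frac{\mathrm{Tr}(H_{lm})}{2^n}I+\boldsymbol\eta_{lm}\cdot\boldsymbol\sigma_n$, and $N_{lm}$ is the number of its non-zero entries. (If the first denominator is $0$, both gradients are $0$ and the value of $s$ is immaterial.) -/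

import Mathlib

open scoped Matrix ComplexOrder

noncomputable section

namespace NoisyVQA

/-- Labels of the `n`-qubit computational basis. -/
abbrev Bits (n : ℕ) : Type := Fin n → Fin 2

/-- Operators on `n` qubits, that is, on a Hilbert space of dimension `2 ^ n`. -/
abbrev Op (n : ℕ) : Type := Matrix (Bits n) (Bits n) ℂ

/-! ### Pauli strings and Pauli coefficients -/

/-- The single-qubit matrices `I, σ_X, σ_Y, σ_Z`, in this order. -/
def pauli : Fin 4 → Matrix (Fin 2) (Fin 2) ℂ :=
  ![1, !![0, 1; 1, 0], !![0, -Complex.I; Complex.I, 0], !![1, 0; 0, -1]]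

/-- The Pauli string `σ_{p 0} ⊗ ⋯ ⊗ σ_{p (n-1)}`, written in the computational basis. -/
def pauliString {n : ℕ} (p : Fin n → Fin 4) : Op n :=
  Matrix.of fun x y => ∏ k, pauli (p k) (x k) (y k)

/-- The Pauli strings other than the identity string. -/
abbrev NontrivialString (n : ℕ) : Type := {p : Fin n → Fin 4 // p ≠ 0}

/-- The identity coefficient `Tr(M) / 2 ^ n` of a Hermitian operator `M`. -/
def identityCoeff {n : ℕ} (M : Op n) : ℝ := M.trace.re / 2 ^ n

/-- The vector `w` with `M = (Tr(M) / 2 ^ n) I + w · σ` for a Hermitian operator `M`: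
`w_p = Tr(M σ_p) / 2 ^ n` for all Pauli strings `p` other than the identity string.
Its norm is the Euclidean norm. -/
def pauliVec {n : ℕ} (M : Op n) : EuclideanSpace ℝ (NontrivialString n) :=
  WithLp.toLp 2 fun p => (M * pauliString p.1).trace.re / 2 ^ n

/-- The maximum norm of a vector of Pauli coefficients. -/
def maxNorm {n : ℕ} (w : EuclideanSpace ℝ (NontrivialString n)) : ℝ := ‖WithLp.ofLp w‖

/-- The number of non-zero entries of a vector of Pauli coefficients. -/
def numNonzero {n : ℕ} (w : EuclideanSpace ℝ (NontrivialString n)) : ℕ :=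
  {p : NontrivialString n | w p ≠ 0}.ncard

/-! ### Local Pauli noise -/

/-- The error probabilities of a single-qubit Pauli channel. -/
structure PauliNoise where
  qX : ℝ
  qY : ℝ
  qZ : ℝ
  qX_nonneg : 0 ≤ qX
  qY_nonneg : 0 ≤ qY
  qZ_nonneg : 0 ≤ qZ
  sum_le_one : qX + qY + qZ ≤ 1

/-- The single-qubit Pauli channel
`ρ ↦ ∑_{i ∈ {X,Y,Z}} q_i σ_i ρ σ_i + (1 - ∑_i q_i) ρ`. -/
def PauliNoise.channel (ν : PauliNoise) (ρ : Matrix (Fin 2) (Fin 2) ℂ) :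
    Matrix (Fin 2) (Fin 2) ℂ :=
  (ν.qX : ℂ) • (pauli 1 * ρ * pauli 1) + (ν.qY : ℂ) • (pauli 2 * ρ * pauli 2)
    + (ν.qZ : ℂ) • (pauli 3 * ρ * pauli 3) + ((1 - (ν.qX + ν.qY + ν.qZ) : ℝ) : ℂ) • ρ

/-- The noise strength `q`: the largest absolute value of the three factors by which the
single-qubit channel multiplies `σ_X`, `σ_Y` and `σ_Z`. -/
def PauliNoise.strength (ν : PauliNoise) : ℝ :=
  max |1 - 2 * ν.qY - 2 * ν.qZ| (max |1 - 2 * ν.qX - 2 * ν.qZ| |1 - 2 * ν.qX - 2 * ν.qY|)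

/-- The `n`-th tensor power of a linear map `P` on single-qubit operators. On matrix units,
`|x⟩⟨y| = ⨂ₖ |xₖ⟩⟨yₖ|` is sent to `⨂ₖ P(|xₖ⟩⟨yₖ|)`, and this is extended linearly. -/
def tensorPower {n : ℕ} (P : Matrix (Fin 2) (Fin 2) ℂ → Matrix (Fin 2) (Fin 2) ℂ) (ρ : Op n) :
    Op n :=
  ∑ x : Bits n, ∑ y : Bits n,
    ρ x y • Matrix.of fun x' y' => ∏ k, P (Matrix.single (x k) (y k) 1) (x' k) (y' k)

/-! ### Noisy variational circuits -/

/-- A layered variational ansatz on `n` qubits. Layers are numbered from `0`; the circuit of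
depth `L` consists of the layers `0, …, L - 1`. -/
structure Ansatz (n : ℕ) where
  numParams : ℕ → ℕ
  H : (l : ℕ) → Fin (numParams l) → Op n
  R : (l : ℕ) → Fin (numParams l) → Op n
  H_hermitian : ∀ l j, (H l j).IsHermitian
  R_hermitian : ∀ l j, (R l j).IsHermitian

/-- The parameters `θ_{lj}` of an ansatz. -/
abbrev Ansatz.Params {n : ℕ} (A : Ansatz n) : Type := (l : ℕ) → Fin (A.numParams l) → ℝ

/-- The parameters `θ` with the entry `θ_{lm}` replaced by `t`. -/
def Ansatz.setParam {n : ℕ} (A : Ansatz n) (θ : A.Params) (l : ℕ) (m : Fin (A.numParams l))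
    (t : ℝ) : A.Params :=
  Function.update θ l (Function.update (θ l) m t)

/-- The unitary `U_l(θ_l) = exp(-i ∑_j (θ_{lj} H_{lj} + R_{lj}))` of layer `l`. -/
def Ansatz.layerUnitary {n : ℕ} (A : Ansatz n) (θ : A.Params) (l : ℕ) : Op n :=
  NormedSpace.exp (-Complex.I • ∑ j, ((θ l j : ℂ) • A.H l j + A.R l j))

/-- The output state of the noisy circuit of depth `L` on the input `ρ₀`: each layer applies its
unitary and then the Pauli channel on every qubit. -/
def Ansatz.noisyState {n : ℕ} (A : Ansatz n) (ν : PauliNoise) (ρ₀ : Op n) (θ : A.Params) :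
    ℕ → Op n
  | 0 => ρ₀
  | l + 1 => tensorPower ν.channel
      (A.layerUnitary θ l * A.noisyState ν ρ₀ θ l * (A.layerUnitary θ l)ᴴ)

/-- A density operator. -/
def IsDensity {n : ℕ} (ρ : Op n) : Prop := ρ.PosSemidef ∧ ρ.trace = 1

/-! ### Truncated observables and cost functions -/

/-- An eigendecomposition `O = ∑ᵢ λᵢ |i⟩⟨i|` of an observable on `n` qubits, together with a
subspace spanned by some of the eigenvectors `|i⟩`, given by the set `S` of their indices. -/
structure TruncatedObservable (n : ℕ) where
  eigenbasis : OrthonormalBasis (Bits n) ℂ (EuclideanSpace ℂ (Bits n))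
  eigenvalue : Bits n → ℝ
  S : Finset (Bits n)

namespace TruncatedObservable

variable {n : ℕ} (T : TruncatedObservable n)

/-- The projector `|i⟩⟨i|`. -/
def proj (i : Bits n) : Op n :=
  Matrix.vecMulVec (WithLp.ofLp (T.eigenbasis i)) (star (WithLp.ofLp (T.eigenbasis i)))

/-- `O₁ = ∑_{i ∈ S} λᵢ |i⟩⟨i|`. -/
def O₁ : Op n := ∑ i ∈ T.S, (T.eigenvalue i : ℂ) • T.proj i

/-- `O₂ = ∑_{i ∈ S} |i⟩⟨i|`. -/
def O₂ : Op n := ∑ i ∈ T.S, T.proj i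

/-- The traceless observable `O₁' = O₁ - (Tr(O₁) / 2 ^ n) I`. -/
def O₁' : Op n := T.O₁ - (T.O₁.trace / 2 ^ n) • (1 : Op n)

/-- The traceless observable `O₂' = O₂ - (Tr(O₂) / 2 ^ n) I`. -/
def O₂' : Op n := T.O₂ - (T.O₂.trace / 2 ^ n) • (1 : Op n)

/-- The probability `pᵢ = ⟨i|ρ|i⟩` of measuring `|i⟩` in the state `ρ`. -/
def prob (ρ : Op n) (i : Bits n) : ℝ :=
  (star (WithLp.ofLp (T.eigenbasis i)) ⬝ᵥ (ρ *ᵥ WithLp.ofLp (T.eigenbasis i))).re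

/-- The cost `C₁ = (∑_{i ∈ S} λᵢ pᵢ) / (∑_{i ∈ S} pᵢ)` in the truncated subspace. -/
def C₁ (ρ : Op n) : ℝ := (∑ i ∈ T.S, T.eigenvalue i * T.prob ρ i) / ∑ i ∈ T.S, T.prob ρ i

/-- The cost `C₂ = Tr(ρ O₁') / Tr(ρ O₂')` with traceless observables. -/
def C₂ (ρ : Op n) : ℝ := (ρ * T.O₁').trace.re / (ρ * T.O₂').trace.re

/-- `k₁ = Tr(O₁) / 2 ^ n`. -/
def k₁ : ℝ := identityCoeff T.O₁

/-- `k₂ = Tr(O₂) / 2 ^ n`. -/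
def k₂ : ℝ := identityCoeff T.O₂

/-- The Pauli coefficients in `O₁ = k₁ I + w₁ · σ`. -/
def w₁ : EuclideanSpace ℝ (NontrivialString n) := pauliVec T.O₁

/-- The Pauli coefficients in `O₂ = k₂ I + w₂ · σ`. -/
def w₂ : EuclideanSpace ℝ (NontrivialString n) := pauliVec T.O₂

/-- The constant `s`, for noise strength `q`, a number `ε > 0`, a depth `L₀` and the generator
`H = H_{lm}` of the parameter. The denominator of the first entry of the minimum vanishes only
if `H` is a multiple of the identity or if `λᵢ` is the same for all `i ∈ S`; in both cases the
gradients of `C₁` and of `C₂` are zero, so that the value of `s` plays no role. -/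
def s (q ε : ℝ) (L₀ : ℕ) (H : Op n) : ℝ :=
  min
    (ε ^ 2 * T.k₂ ^ 2 /
      ((1 + ε) ^ 2 * √(2 ^ (n + 1) - 2) * numNonzero (pauliVec H) * maxNorm (pauliVec H)
        * ‖T.k₂ • T.w₁ - T.k₁ • T.w₂‖))
    ((|T.k₂| / (q ^ L₀ * √(2 ^ n - 1) * ‖T.w₂‖) - q ^ (L₀ + 1)) ^ 2)

end TruncatedObservable

end NoisyVQA

end

/-! The Bloch vector `r` of a state, with entries `Tr(ρ σ_p)`, has norm at most `√(2 ^ n - 1)`. A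
unitary preserves this norm and the noise contracts it by `q`, so that `‖r‖ ≤ q ^ L √(2 ^ n - 1)`
after `L` layers. For a Pauli string `P` the commutator `-i [P, ·]` is the difference of two unitary
conjugations, so changing a Hamiltonian by `K` moves a Bloch vector of norm one by at most twice
the `ℓ¹` norm of the Pauli coefficients of `K`. This gives
`‖∂r‖ ≤ 2 N ‖η‖_∞ q ^ L √(2 ^ n - 1)`.

With `aᵢ = ⟪r, wᵢ⟫` the costs are `C₁ = (k₁ + a₁) / (k₂ + a₂)` and `C₂ = a₁ / a₂`, hence
`(k₂ + a₂)² ∂C₁ = a₂² ∂C₂ + ⟪∂r, k₂ w₁ - k₁ w₂⟫`. As `O₂` is a projector,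
`|k₂| ≤ √(2 ^ n - 1) ‖w₂‖`, so the choice of `L₀` yields `q ^ L₀ (1 + ε) ≤ 1`. From depth `2 L₀ + 2`
on, `a₂` is therefore so small compared with `k₂` that `s a₂²` and `s |⟪∂r, k₂ w₁ - k₁ w₂⟫|` are
both at most `q ^ (L + 1) (k₂ + a₂)²`. -/

noncomputable section

namespace NoisyVQA

/-! ### Hermitian matrices and the Pauli basis -/

lemma isHermitian_smul {ι : Type*} {M : Matrix ι ι ℂ} (c : ℝ) (hM : M.IsHermitian) :
    (c • M).IsHermitian :=
  hM.smul (IsSelfAdjoint.all c)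

section Hermitian

variable {ι : Type*} [Fintype ι]

lemma ofReal_re_trace {M : Matrix ι ι ℂ} (hM : M.IsHermitian) : (M.trace.re : ℂ) = M.trace :=
  Complex.conj_eq_iff_re.mp <| by rw [starRingEnd_apply, ← Matrix.trace_conjTranspose, hM.eq]

lemma ofReal_re_trace_mul {M N : Matrix ι ι ℂ} (hM : M.IsHermitian) (hN : N.IsHermitian) :
    ((M * N).trace.re : ℂ) = (M * N).trace :=
  Complex.conj_eq_iff_re.mp <| by
    rw [starRingEnd_apply, ← Matrix.trace_conjTranspose, Matrix.conjTranspose_mul, hM.eq, hN.eq,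
      Matrix.trace_mul_comm]

lemma trace_mul_eq_sum {R : Type*} [NonUnitalNonAssocSemiring R] (M N : Matrix ι ι R) :
    (M * N).trace = ∑ x, ∑ y, M x y * N y x := by
  simp only [Matrix.trace, Matrix.diag_apply, Matrix.mul_apply]

lemma re_trace_mul_self_le_sq {ρ : Matrix ι ι ℂ} (hρ : ρ.PosSemidef) :
    (ρ * ρ).trace.re ≤ ρ.trace.re ^ 2 := by
  have diag_real (x : ι) : (ρ x x).im = 0 :=
    (Complex.nonneg_iff.mp hρ.diag_nonneg).2.symm
  have minor_nonneg (x y : ι) : (ρ x y * ρ y x).re ≤ (ρ x x).re * (ρ y y).re := by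
    have h := (Complex.nonneg_iff.mp (hρ.submatrix ![x, y]).det_nonneg).1
    rw [Matrix.det_fin_two] at h
    simp only [Matrix.submatrix_apply, Matrix.cons_val_zero, Matrix.cons_val_one, Complex.sub_re,
      Complex.mul_re, diag_real, mul_zero, sub_zero] at h ⊢
    linarith
  rw [trace_mul_eq_sum, Matrix.trace, sq]
  simp only [Complex.re_sum, Finset.sum_mul_sum, Matrix.diag_apply]
  exact Finset.sum_le_sum fun x _ => Finset.sum_le_sum fun y _ => minor_nonneg x y

end Hermitian

variable {n : ℕ}

lemma isHermitian_pauli (a : Fin 4) : (pauli a).IsHermitian := by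
  ext i j
  fin_cases a <;> fin_cases i <;> fin_cases j <;> simp [pauli]

lemma pauli_mul_self (a : Fin 4) : pauli a * pauli a = 1 := by
  ext i j
  fin_cases a <;> fin_cases i <;> fin_cases j <;> simp [pauli]

lemma sum_pauli_mul_pauli (i j k l : Fin 2) :
    ∑ a, pauli a i j * pauli a k l = if i = l ∧ j = k then 2 else 0 := by
  fin_cases i <;> fin_cases j <;> fin_cases k <;> fin_cases l <;>
    simp [pauli, Fin.sum_univ_four] <;> norm_num

lemma isHermitian_pauliString (p : Fin n → Fin 4) : (pauliString p).IsHermitian := by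
  ext x y
  simp only [Matrix.conjTranspose_apply, pauliString, Matrix.of_apply, star_prod,
    (isHermitian_pauli _).apply]

lemma prod_one_apply (x y : Bits n) :
    ∏ k, (1 : Matrix (Fin 2) (Fin 2) ℂ) (x k) (y k) = (1 : Op n) x y := by
  simp [Matrix.one_apply, funext_iff, Finset.prod_ite_zero]

lemma pauliString_zero : pauliString (0 : Fin n → Fin 4) = 1 := by
  ext x y
  exact prod_one_apply x y

lemma pauliString_mul_self (p : Fin n → Fin 4) : pauliString p * pauliString p = 1 := by
  ext x z
  simp only [Matrix.mul_apply, pauliString, Matrix.of_apply, ← Finset.prod_mul_distrib]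
  rw [← Fintype.prod_sum fun k a => pauli (p k) (x k) a * pauli (p k) a (z k)]
  simp only [← Matrix.mul_apply, pauli_mul_self, prod_one_apply]

lemma sum_pauliString_mul_pauliString (x y x' y' : Bits n) :
    ∑ p : Fin n → Fin 4, pauliString p x y * pauliString p x' y' =
      if x = y' ∧ y = x' then 2 ^ n else 0 := by
  simp only [pauliString, Matrix.of_apply, ← Finset.prod_mul_distrib]
  rw [← Fintype.prod_sum fun k a => pauli a (x k) (y k) * pauli a (x' k) (y' k)]
  simp [sum_pauli_mul_pauli, Finset.prod_ite_zero, funext_iff, forall_and]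

lemma sum_trace_smul_pauliString (M : Op n) :
    ∑ p : Fin n → Fin 4, (M * pauliString p).trace • pauliString p = (2 ^ n : ℂ) • M := by
  ext x y
  simp only [Matrix.sum_apply, Matrix.smul_apply, smul_eq_mul, trace_mul_eq_sum, Finset.sum_mul,
    mul_assoc]
  rw [Finset.sum_comm]
  simp_rw [Finset.sum_comm (s := (Finset.univ : Finset (Fin n → Fin 4))), ← Finset.mul_sum,
    sum_pauliString_mul_pauliString]
  rw [Finset.sum_eq_single x (by simp +contextual) (by simp),
    Finset.sum_eq_single y (by simp +contextual) (by simp)]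
  simp [mul_comm]

lemma sum_trace_mul_trace (M N : Op n) :
    ∑ p : Fin n → Fin 4, (M * pauliString p).trace * (N * pauliString p).trace =
      2 ^ n * (M * N).trace := by
  have h := congrArg (fun X => (N * X).trace) (sum_trace_smul_pauliString M)
  simpa only [Matrix.mul_sum, Matrix.trace_sum, Matrix.mul_smul, Matrix.trace_smul, smul_eq_mul,
    Matrix.trace_mul_comm N M] using h

lemma pauli_expansion {M : Op n} (hM : M.IsHermitian) :
    M = identityCoeff M • (1 : Op n) +
      ∑ p : NontrivialString n, pauliVec M p • pauliString p.1 := by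
  have coeff (p : Fin n → Fin 4) : (M * pauliString p).trace • pauliString p =
      (M * pauliString p).trace.re • pauliString p := by
    rw [← Complex.coe_smul, ofReal_re_trace_mul hM (isHermitian_pauliString p)]
  have h : (2 ^ n : ℝ) • M = ∑ p, (M * pauliString p).trace.re • pauliString p := by
    rw [← Complex.coe_smul, ← Finset.sum_congr rfl fun p _ => coeff p,
      sum_trace_smul_pauliString]
    norm_num
  rw [← eq_inv_smul_iff₀ (by positivity), Fintype.sum_eq_add_sum_subtype_ne _ 0,
    pauliString_zero, mul_one, smul_add, Finset.smul_sum] at h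
  simp only [smul_smul, ← div_eq_inv_mul] at h
  exact h

/-- The Bloch vector of an operator, with entries `Tr(M σ_p)` for all Pauli strings `p` other than
the identity string. It is used for states, whereas observables and generators are described by
the vector `pauliVec`, which is smaller by a factor of `2 ^ n`. -/
def blochVec : Op n →L[ℝ] EuclideanSpace ℝ (NontrivialString n) :=
  LinearMap.toContinuousLinearMap
    { toFun := fun M => WithLp.toLp 2 fun p => (M * pauliString p.1).trace.re
      map_add' := fun M N => by ext p; simp [add_mul]
      map_smul' := fun c M => by ext p; simp }

lemma blochVec_apply (M : Op n) (p : NontrivialString n) :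
    blochVec M p = (M * pauliString p.1).trace.re := rfl

lemma pauliVec_eq_smul_blochVec (M : Op n) : pauliVec M = (2 ^ n : ℝ)⁻¹ • blochVec M := by
  ext p
  exact div_eq_inv_mul _ _

lemma re_trace_mul_eq {M N : Op n} (hM : M.IsHermitian) (hN : N.IsHermitian) :
    (M * N).trace.re = M.trace.re * identityCoeff N + inner ℝ (blochVec M) (pauliVec N) := by
  have trace_real {X : Op n} (hX : X.IsHermitian) (p : Fin n → Fin 4) :=
    (ofReal_re_trace_mul hX (isHermitian_pauliString p)).symm
  have h := sum_trace_mul_trace M N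
  rw [Finset.sum_congr rfl fun p _ => congrArg₂ (· * ·) (trace_real hM p) (trace_real hN p),
    ← ofReal_re_trace_mul hM hN] at h
  norm_cast at h
  rw [Fintype.sum_eq_add_sum_subtype_ne _ 0, pauliString_zero, mul_one, mul_one] at h
  rw [pauliVec_eq_smul_blochVec, real_inner_smul_right, PiLp.inner_apply, identityCoeff]
  simp only [blochVec_apply, RCLike.inner_apply, conj_trivial]
  field_simp
  push_cast at h
  rw [mul_comm, ← h]
  simp only [mul_comm]

lemma norm_blochVec_sq {M : Op n} (hM : M.IsHermitian) :
    ‖blochVec M‖ ^ 2 = 2 ^ n * (M * M).trace.re - M.trace.re ^ 2 := by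
  rw [re_trace_mul_eq hM hM, pauliVec_eq_smul_blochVec, real_inner_smul_right,
    real_inner_self_eq_norm_sq, identityCoeff]
  field_simp
  ring

lemma IsDensity.norm_blochVec_le {ρ : Op n} (hρ : IsDensity ρ) :
    ‖blochVec ρ‖ ≤ √(2 ^ n - 1) := by
  have purity_le_one : (ρ * ρ).trace.re ≤ 1 := by
    simpa [hρ.2] using re_trace_mul_self_le_sq hρ.1
  refine Real.le_sqrt_of_sq_le ?_
  rw [norm_blochVec_sq hρ.1.isHermitian, hρ.2, Complex.one_re, one_pow]
  gcongr
  exact mul_le_of_le_one_right (by positivity) purity_le_one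

lemma norm_blochVec_conj {U M : Op n} (hU : U ∈ Matrix.unitaryGroup (Bits n) ℂ)
    (hM : M.IsHermitian) : ‖blochVec (U * M * Uᴴ)‖ = ‖blochVec M‖ := by
  have hUU : Uᴴ * U = 1 := Matrix.mem_unitaryGroup_iff'.mp hU
  have htr (X : Op n) : (U * X * Uᴴ).trace = X.trace := by
    rw [Matrix.trace_mul_comm, ← mul_assoc, hUU, one_mul]
  have hsq : U * M * Uᴴ * (U * M * Uᴴ) = U * (M * M) * Uᴴ := by
    calc U * M * Uᴴ * (U * M * Uᴴ) = U * M * (Uᴴ * U) * M * Uᴴ := by simp only [mul_assoc]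
      _ = U * (M * M) * Uᴴ := by rw [hUU, mul_one, mul_assoc U M M]
  rw [← sq_eq_sq₀ (norm_nonneg _) (norm_nonneg _), norm_blochVec_sq hM,
    norm_blochVec_sq (Matrix.isHermitian_mul_mul_conjTranspose U hM), hsq, htr, htr]

/-! ### Time evolution -/

/-- The `ℓ¹` norm of the vector of Pauli coefficients of an operator, which measures the size of
Hamiltonians. -/
def pauliL1 (M : Op n) : ℝ := ∑ p, |pauliVec M p|

lemma pauliL1_nonneg (M : Op n) : 0 ≤ pauliL1 M := Finset.sum_nonneg fun _ _ => abs_nonneg _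

lemma pauliL1_smul (c : ℝ) (M : Op n) : pauliL1 (c • M) = |c| * pauliL1 M := by
  simp only [pauliL1, pauliVec_eq_smul_blochVec, map_smul, PiLp.smul_apply, smul_eq_mul,
    abs_mul, Finset.mul_sum, mul_left_comm]

lemma pauliL1_zero : pauliL1 (0 : Op n) = 0 := by
  simpa using pauliL1_smul 0 (0 : Op n)

lemma pauliL1_le (M : Op n) : pauliL1 M ≤ numNonzero (pauliVec M) * maxNorm (pauliVec M) := by
  classical
  set w := pauliVec M
  calc pauliL1 M = ∑ p with w p ≠ 0, |w p| :=
        (Finset.sum_filter_of_ne fun p _ => abs_ne_zero.mp).symm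
    _ ≤ ({p | w p ≠ 0} : Finset _).card • maxNorm w :=
        Finset.sum_le_card_nsmul _ _ _ fun p _ => norm_le_pi_norm (WithLp.ofLp w) p
    _ = numNonzero w * maxNorm w := by
        rw [nsmul_eq_mul, numNonzero, ← Set.ncard_coe_finset, Finset.coe_filter_univ]

section Evolution

variable {ι : Type*} [Fintype ι]

/-- The generator `M ↦ -i [G, M]` of the time evolution under the Hamiltonian `G`. -/
def liouvillian (G M : Matrix ι ι ℂ) : Matrix ι ι ℂ := -Complex.I • ⁅G, M⁆

lemma isHermitian_liouvillian {G M : Matrix ι ι ℂ} (hG : G.IsHermitian) (hM : M.IsHermitian) :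
    (liouvillian G M).IsHermitian := by
  rw [Matrix.IsHermitian, liouvillian, Ring.lie_def, Matrix.conjTranspose_smul,
    Matrix.conjTranspose_sub, Matrix.conjTranspose_mul, Matrix.conjTranspose_mul, hG.eq, hM.eq,
    star_neg, Complex.star_def, Complex.conj_I, neg_neg, ← neg_sub (G * M), smul_neg, neg_smul]

variable [DecidableEq ι]

/-- The state at time one of the evolution `M' = -i [G, M]` that starts in `M`. -/
def evolve (G M : Matrix ι ι ℂ) : Matrix ι ι ℂ :=
  NormedSpace.exp (-Complex.I • G) * M * NormedSpace.exp (Complex.I • G)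

lemma conjTranspose_exp_neg_I_smul {G : Matrix ι ι ℂ} (hG : G.IsHermitian) :
    (NormedSpace.exp (-Complex.I • G))ᴴ = NormedSpace.exp (Complex.I • G) := by
  rw [← Matrix.exp_conjTranspose, Matrix.conjTranspose_smul, hG.eq, star_neg, Complex.star_def,
    Complex.conj_I, neg_neg]

lemma evolve_eq_conj {G : Matrix ι ι ℂ} (hG : G.IsHermitian) (M : Matrix ι ι ℂ) :
    evolve G M =
      NormedSpace.exp (-Complex.I • G) * M * (NormedSpace.exp (-Complex.I • G))ᴴ := by
  rw [evolve, conjTranspose_exp_neg_I_smul hG]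

lemma exp_I_smul_mul_exp_neg_I_smul (G : Matrix ι ι ℂ) :
    NormedSpace.exp (Complex.I • G) * NormedSpace.exp (-Complex.I • G) = 1 := by
  rw [← Matrix.exp_add_of_commute _ _ (((Commute.refl G).smul_left _).smul_right _), ← add_smul,
    add_neg_cancel, zero_smul, NormedSpace.exp_zero]

lemma exp_neg_I_smul_mem_unitaryGroup {G : Matrix ι ι ℂ} (hG : G.IsHermitian) :
    NormedSpace.exp (-Complex.I • G) ∈ Matrix.unitaryGroup ι ℂ := by
  rw [Matrix.mem_unitaryGroup_iff', Matrix.star_eq_conjTranspose, conjTranspose_exp_neg_I_smul hG,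
    exp_I_smul_mul_exp_neg_I_smul]

lemma isHermitian_evolve {G M : Matrix ι ι ℂ} (hG : G.IsHermitian) (hM : M.IsHermitian) :
    (evolve G M).IsHermitian := by
  rw [evolve_eq_conj hG]
  exact Matrix.isHermitian_mul_mul_conjTranspose _ hM

lemma trace_evolve (G M : Matrix ι ι ℂ) : (evolve G M).trace = M.trace := by
  rw [evolve, Matrix.trace_mul_comm, ← mul_assoc, exp_I_smul_mul_exp_neg_I_smul, one_mul]

lemma evolve_zero (M : Matrix ι ι ℂ) : evolve 0 M = M := by simp [evolve]

lemma evolve_sub (G M N : Matrix ι ι ℂ) : evolve G (M - N) = evolve G M - evolve G N := by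
  simp only [evolve, mul_sub, sub_mul]

lemma commute_exp_smul (c : ℂ) (s : ℝ) (K : Matrix ι ι ℂ) :
    Commute K (NormedSpace.exp (c • s • K)) := by
  open scoped Matrix.Norms.Operator in
  exact (((Commute.refl K).smul_right s).smul_right c).exp_right

lemma evolve_smul_liouvillian (K M : Matrix ι ι ℂ) (s : ℝ) :
    evolve (s • K) (liouvillian K M) = liouvillian K (evolve (s • K) M) := by
  simp only [evolve, liouvillian, Ring.lie_def, mul_smul_comm, smul_mul_assoc, mul_sub, sub_mul]
  simp only [← mul_assoc, (commute_exp_smul _ s K).eq]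
  simp only [mul_assoc, (commute_exp_smul _ s K).eq]

section Calculus

open scoped Matrix.Norms.Operator

lemma hasDerivAt_evolve (G : Matrix ι ι ℂ) {φ : ℝ → ℝ} {φ' s : ℝ} (hφ : HasDerivAt φ φ' s)
    {X : ℝ → Matrix ι ι ℂ} {X' : Matrix ι ι ℂ} (hX : HasDerivAt X X' s) :
    HasDerivAt (fun s => evolve (φ s • G) (X s))
      (evolve (φ s • G) (φ' • liouvillian G (X s) + X')) s := by
  have left : HasDerivAt (fun s => NormedSpace.exp (-Complex.I • φ s • G))
      (φ' • (NormedSpace.exp (-Complex.I • φ s • G) * (-Complex.I • G))) s := by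
    simp only [smul_comm (-Complex.I)]
    exact (hasDerivAt_exp_smul_const (𝕂 := ℝ) (-Complex.I • G) (φ s)).scomp s hφ
  have right : HasDerivAt (fun s => NormedSpace.exp (Complex.I • φ s • G))
      (φ' • ((Complex.I • G) * NormedSpace.exp (Complex.I • φ s • G))) s := by
    simp only [smul_comm Complex.I]
    exact (hasDerivAt_exp_smul_const' (𝕂 := ℝ) (Complex.I • G) (φ s)).scomp s hφ
  convert! (left.mul hX).mul right using 1
  simp only [evolve, liouvillian, Ring.lie_def, Pi.mul_apply, mul_add, add_mul, mul_assoc,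
    smul_mul_assoc, mul_smul_comm, smul_sub, mul_sub, sub_mul, neg_smul, smul_neg, neg_mul, mul_neg]
  abel

lemma differentiableAt_evolve {G X : ℝ → Matrix ι ι ℂ} {t : ℝ} (hG : DifferentiableAt ℝ G t)
    (hX : DifferentiableAt ℝ X t) : DifferentiableAt ℝ (fun t => evolve (G t) (X t)) t := by
  have exp_comp (c : ℂ) : DifferentiableAt ℝ (fun t => NormedSpace.exp (c • G t)) t :=
    (NormedSpace.exp_analytic (𝕂 := ℝ) (c • G t)).differentiableAt.comp t (hG.const_smul c)
  exact ((exp_comp _).mul hX).mul (exp_comp _)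

end Calculus

end Evolution

section Duhamel

open scoped Matrix.Norms.Operator

lemma norm_blochVec_liouvillian_involution_le {P M : Op n} (hP : P.IsHermitian)
    (hPP : P * P = 1) (hM : M.IsHermitian) :
    ‖blochVec (liouvillian P M)‖ ≤ 2 * ‖blochVec M‖ := by
  obtain ⟨c, hcc, hc⟩ : ∃ c : ℂ, c * c = 2⁻¹ ∧ star c = c := by
    refine ⟨((√2)⁻¹ : ℝ), ?_, Complex.conj_ofReal _⟩
    rw [← Complex.ofReal_mul, ← mul_inv, Real.mul_self_sqrt zero_le_two]
    norm_num
  -- `U = exp(-iπP/4)`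
  set U : Op n := c • (1 - Complex.I • P)
  have hUH : Uᴴ = c • (1 + Complex.I • P) := by
    simp [U, hc, hP.eq, Matrix.conjTranspose_smul]
  have hU : U ∈ Matrix.unitaryGroup (Bits n) ℂ := by
    rw [Matrix.mem_unitaryGroup_iff, Matrix.star_eq_conjTranspose, hUH, smul_mul_smul_comm, hcc]
    simp only [sub_mul, mul_add, one_mul, mul_one, smul_mul_smul_comm, Complex.I_mul_I, hPP]
    module
  have hUH' : Uᴴ ∈ Matrix.unitaryGroup (Bits n) ℂ := Unitary.star_mem hU
  have split : liouvillian P M = U * M * Uᴴ - Uᴴ * M * Uᴴᴴ := by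
    have pull_scalars (A B : Op n) : c • A * M * c • B = (2⁻¹ : ℂ) • (A * M * B) := by
      rw [smul_mul_assoc, smul_mul_smul_comm, hcc]
    rw [Matrix.conjTranspose_conjTranspose, hUH, pull_scalars, pull_scalars]
    simp only [liouvillian, Ring.lie_def, sub_mul, mul_sub, add_mul, mul_add, one_mul, mul_one,
      Matrix.smul_mul, Matrix.mul_smul]
    module
  rw [split, map_sub, two_mul]
  refine (norm_sub_le _ _).trans_eq ?_
  rw [norm_blochVec_conj hU hM, norm_blochVec_conj hUH' hM]

lemma liouvillian_eq_sum {H : Op n} (hH : H.IsHermitian) (M : Op n) :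
    liouvillian H M = ∑ p, pauliVec H p • liouvillian (pauliString p.1) M := by
  conv_lhs => rw [pauli_expansion hH]
  simp only [liouvillian, Ring.lie_def, add_mul, mul_add, Finset.sum_mul, Finset.mul_sum,
    smul_mul_assoc, mul_smul_comm, one_mul, mul_one, add_sub_add_left_eq_sub,
    ← Finset.sum_sub_distrib, ← smul_sub, Finset.smul_sum, smul_comm Complex.I, neg_smul, smul_neg,
    Finset.sum_neg_distrib]

lemma norm_blochVec_liouvillian_le {H M : Op n} (hH : H.IsHermitian) (hM : M.IsHermitian) :
    ‖blochVec (liouvillian H M)‖ ≤ 2 * pauliL1 H * ‖blochVec M‖ := by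
  rw [liouvillian_eq_sum hH, map_sum, pauliL1, mul_assoc, Finset.sum_mul, Finset.mul_sum]
  refine norm_sum_le_of_le _ fun p _ => ?_
  rw [map_smul, norm_smul, Real.norm_eq_abs, mul_left_comm]
  gcongr
  exact norm_blochVec_liouvillian_involution_le (isHermitian_pauliString _)
    (pauliString_mul_self _) hM

lemma norm_blochVec_evolve {G M : Op n} (hG : G.IsHermitian) (hM : M.IsHermitian) :
    ‖blochVec (evolve G M)‖ = ‖blochVec M‖ := by
  rw [evolve_eq_conj hG, norm_blochVec_conj (exp_neg_I_smul_mem_unitaryGroup hG) hM]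

lemma norm_blochVec_evolve_sub_evolve_le {K G M : Op n} (hK : K.IsHermitian) (hG : G.IsHermitian)
    (hM : M.IsHermitian) :
    ‖blochVec (evolve K M - evolve G M)‖ ≤ 2 * pauliL1 (K - G) * ‖blochVec M‖ := by
  -- Duhamel: on the path `X` from `evolve G M` to `evolve K M` only `K - G` enters the speed.
  let X (s : ℝ) : Op n := evolve ((1 - s) • G) (evolve (s • K) M)
  have hX (s : ℝ) :
      HasDerivAt X (evolve ((1 - s) • G) (liouvillian (K - G) (evolve (s • K) M))) s := by
    have inner := hasDerivAt_evolve K (hasDerivAt_id s) (hasDerivAt_const s M)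
    convert! hasDerivAt_evolve G ((hasDerivAt_id s).const_sub 1) inner using 2
    simp only [id_eq, one_smul, add_zero, neg_smul, evolve_smul_liouvillian]
    simp only [liouvillian, Ring.lie_def, sub_mul, mul_sub]
    module
  have speed (s : ℝ) :
      ‖blochVec (evolve ((1 - s) • G) (liouvillian (K - G) (evolve (s • K) M)))‖ ≤
        2 * pauliL1 (K - G) * ‖blochVec M‖ := by
    have hsK := isHermitian_smul s hK
    have hE := isHermitian_evolve hsK hM
    rw [norm_blochVec_evolve (isHermitian_smul _ hG) (isHermitian_liouvillian (hK.sub hG) hE),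
      ← norm_blochVec_evolve hsK hM]
    exact norm_blochVec_liouvillian_le (hK.sub hG) hE
  have h := norm_image_sub_le_of_norm_deriv_le_segment_01'
    (fun s _ => (blochVec.hasFDerivAt.comp_hasDerivAt s (hX s)).hasDerivWithinAt)
    (fun s _ => speed s)
  simpa [X, evolve_zero] using h

end Duhamel

/-! ### Pauli noise and noisy circuits -/

/-- The factors by which the single-qubit Pauli channel multiplies `I, σ_X, σ_Y, σ_Z`. -/
def PauliNoise.factor (ν : PauliNoise) : Fin 4 → ℝ :=
  ![1, 1 - 2 * ν.qY - 2 * ν.qZ, 1 - 2 * ν.qX - 2 * ν.qZ, 1 - 2 * ν.qX - 2 * ν.qY]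

lemma PauliNoise.sum_channel_single_mul_pauli (ν : PauliNoise) (a : Fin 4) (i j : Fin 2) :
    ∑ x, ∑ y, ν.channel (Matrix.single i j 1) x y * pauli a y x = ν.factor a * pauli a j i := by
  have matrix_unit : Matrix.single i j (1 : ℂ) = !![if i = 0 ∧ j = 0 then 1 else 0,
      if i = 0 ∧ j = 1 then 1 else 0; if i = 1 ∧ j = 0 then 1 else 0,
      if i = 1 ∧ j = 1 then 1 else 0] := by
    ext x y
    fin_cases x <;> fin_cases y <;> simp [Matrix.single]
  rw [matrix_unit]
  fin_cases a <;> fin_cases i <;> fin_cases j <;>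
    simp [channel, factor, pauli, Fin.sum_univ_two] <;> ring_nf

lemma PauliNoise.star_channel_single (ν : PauliNoise) (i j x y : Fin 2) :
    star (ν.channel (Matrix.single i j 1) x y) = ν.channel (Matrix.single j i 1) y x := by
  have h : (ν.channel (Matrix.single i j 1))ᴴ = ν.channel (Matrix.single j i 1) := by
    simp [channel, Matrix.conjTranspose_smul, (isHermitian_pauli _).eq, mul_assoc]
  rw [← h, Matrix.conjTranspose_apply]

lemma PauliNoise.strength_nonneg (ν : PauliNoise) : 0 ≤ ν.strength :=
  le_max_of_le_left (abs_nonneg _)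

lemma PauliNoise.abs_factor_le_one (ν : PauliNoise) (a : Fin 4) : |ν.factor a| ≤ 1 := by
  obtain ⟨x, y, z, hx, hy, hz, h⟩ := ν
  fin_cases a <;> simp only [factor, abs_le] <;> constructor <;> simp <;> linarith

lemma PauliNoise.strength_le_one (ν : PauliNoise) : ν.strength ≤ 1 :=
  max_le (ν.abs_factor_le_one 1) (max_le (ν.abs_factor_le_one 2) (ν.abs_factor_le_one 3))

lemma PauliNoise.abs_factor_le_strength (ν : PauliNoise) {a : Fin 4} (ha : a ≠ 0) :
    |ν.factor a| ≤ ν.strength := by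
  fin_cases a
  · exact absurd rfl ha
  · exact le_max_left _ _
  · exact (le_max_left _ _).trans (le_max_right _ _)
  · exact (le_max_right _ _).trans (le_max_right _ _)

lemma PauliNoise.abs_prod_factor_le_strength (ν : PauliNoise) {p : Fin n → Fin 4} (hp : p ≠ 0) :
    |∏ k, ν.factor (p k)| ≤ ν.strength := by
  obtain ⟨k, hk⟩ := Function.ne_iff.mp hp
  rw [Finset.abs_prod, ← Finset.mul_prod_erase _ _ (Finset.mem_univ k)]
  exact (mul_le_of_le_one_right (abs_nonneg _) (Finset.prod_le_one (fun _ _ => abs_nonneg _)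
    fun _ _ => ν.abs_factor_le_one _)).trans (ν.abs_factor_le_strength hk)

/-- `tensorPower P` as a continuous linear map. -/
def tensorPowerL (P : Matrix (Fin 2) (Fin 2) ℂ → Matrix (Fin 2) (Fin 2) ℂ) : Op n →L[ℝ] Op n :=
  LinearMap.toContinuousLinearMap
    { toFun := tensorPower P
      map_add' := fun M N => by
        simp only [tensorPower, Matrix.add_apply, add_smul, Finset.sum_add_distrib]
      map_smul' := fun c M => by
        simp only [tensorPower, RingHom.id_apply, Matrix.smul_apply, smul_assoc, Finset.smul_sum] }

lemma trace_tensorPower_mul_pauliString (ν : PauliNoise) (ρ : Op n) (p : Fin n → Fin 4) :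
    (tensorPower ν.channel ρ * pauliString p).trace =
      (∏ k, ν.factor (p k) : ℝ) * (ρ * pauliString p).trace := by
  have on_matrix_unit (x y : Bits n) : (Matrix.of (fun x' y' : Bits n =>
      ∏ k, ν.channel (Matrix.single (x k) (y k) 1) (x' k) (y' k)) * pauliString p).trace =
      (∏ k, ν.factor (p k) : ℝ) * pauliString p y x := by
    simp only [trace_mul_eq_sum, pauliString, Matrix.of_apply, Complex.ofReal_prod,
      ← Finset.prod_mul_distrib, ← ν.sum_channel_single_mul_pauli, Fintype.prod_sum]
  simp only [tensorPower, Finset.sum_mul, Matrix.trace_sum, Matrix.smul_mul, Matrix.trace_smul,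
    on_matrix_unit, trace_mul_eq_sum ρ, Finset.mul_sum, smul_eq_mul, mul_left_comm]

lemma isHermitian_tensorPower (ν : PauliNoise) {ρ : Op n} (hρ : ρ.IsHermitian) :
    (tensorPower ν.channel ρ).IsHermitian := by
  ext a b
  simp only [tensorPower, Matrix.conjTranspose_apply, Matrix.sum_apply, Matrix.smul_apply,
    Matrix.of_apply, smul_eq_mul, star_sum, star_mul', star_prod, ν.star_channel_single, hρ.apply]
  exact Finset.sum_comm

lemma trace_tensorPower (ν : PauliNoise) (ρ : Op n) :
    (tensorPower ν.channel ρ).trace = ρ.trace := by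
  simpa [pauliString_zero, PauliNoise.factor] using trace_tensorPower_mul_pauliString ν ρ 0

lemma norm_blochVec_tensorPower_le (ν : PauliNoise) (ρ : Op n) :
    ‖blochVec (tensorPower ν.channel ρ)‖ ≤ ν.strength * ‖blochVec ρ‖ := by
  have entry (p : NontrivialString n) :
      ‖blochVec (tensorPower ν.channel ρ) p‖ ≤ ν.strength * ‖blochVec ρ p‖ := by
    rw [blochVec_apply, trace_tensorPower_mul_pauliString, Complex.re_ofReal_mul, norm_mul]
    exact mul_le_mul_of_nonneg_right (ν.abs_prod_factor_le_strength p.2) (norm_nonneg _)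
  refine le_of_sq_le_sq ?_ (mul_nonneg ν.strength_nonneg (norm_nonneg _))
  rw [mul_pow, EuclideanSpace.norm_sq_eq, EuclideanSpace.norm_sq_eq, Finset.mul_sum]
  gcongr with p
  rw [← mul_pow]
  gcongr
  exact entry p

namespace Ansatz

variable (A : Ansatz n) (ν : PauliNoise)

/-- The Hamiltonian `∑_j (θ_{lj} H_{lj} + R_{lj})` of layer `l`. -/
def generator (θ : A.Params) (l : ℕ) : Op n := ∑ j, ((θ l j : ℂ) • A.H l j + A.R l j)

lemma isHermitian_generator (θ : A.Params) (l : ℕ) : (A.generator θ l).IsHermitian :=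
  isSelfAdjoint_sum _ fun j _ =>
    ((A.H_hermitian l j).smul (Complex.conj_ofReal _)).add (A.R_hermitian l j)

lemma generator_setParam (θ : A.Params) (l : ℕ) (m : Fin (A.numParams l)) (t : ℝ) (j : ℕ) :
    A.generator (A.setParam θ l m t) j =
      A.generator θ j + (t - θ l m) • (if j = l then A.H l m else 0) := by
  split_ifs with h
  · subst h
    rw [← sub_eq_iff_eq_add', generator, generator, ← Finset.sum_sub_distrib,
      Finset.sum_eq_single m (fun i _ hi => by simp [setParam, hi]) (by simp)]
    simp only [setParam, Function.update_self, add_sub_add_right_eq_sub, ← sub_smul,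
      Complex.coe_smul]
  · simp only [generator, setParam, Function.update_of_ne h, smul_zero, add_zero]

lemma setParam_self (θ : A.Params) (l : ℕ) (m : Fin (A.numParams l)) :
    A.setParam θ l m (θ l m) = θ := by
  simp [setParam]

lemma noisyState_succ (ρ₀ : Op n) (θ : A.Params) (l : ℕ) :
    A.noisyState ν ρ₀ θ (l + 1) =
      tensorPowerL ν.channel (evolve (A.generator θ l) (A.noisyState ν ρ₀ θ l)) := by
  rw [evolve_eq_conj (A.isHermitian_generator θ l)]
  rfl

lemma isHermitian_noisyState {ρ₀ : Op n} (hρ₀ : ρ₀.IsHermitian) (θ : A.Params) :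
    ∀ L, (A.noisyState ν ρ₀ θ L).IsHermitian
  | 0 => hρ₀
  | L + 1 => isHermitian_tensorPower ν
      (Matrix.isHermitian_mul_mul_conjTranspose _ (isHermitian_noisyState hρ₀ θ L))

lemma trace_noisyState (ρ₀ : Op n) (θ : A.Params) (L : ℕ) :
    (A.noisyState ν ρ₀ θ L).trace = ρ₀.trace := by
  induction L with
  | zero => rfl
  | succ L ih =>
    rw [noisyState_succ]
    exact (trace_tensorPower ν _).trans ((trace_evolve _ _).trans ih)

lemma norm_blochVec_noisyState_le {ρ₀ : Op n} (hρ₀ : ρ₀.IsHermitian) (θ : A.Params) (L : ℕ) :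
    ‖blochVec (A.noisyState ν ρ₀ θ L)‖ ≤ ν.strength ^ L * ‖blochVec ρ₀‖ := by
  induction L with
  | zero => simp [noisyState]
  | succ L ih =>
    calc ‖blochVec (A.noisyState ν ρ₀ θ (L + 1))‖
        ≤ ν.strength * ‖blochVec (evolve (A.generator θ L) (A.noisyState ν ρ₀ θ L))‖ := by
          rw [noisyState_succ]
          exact norm_blochVec_tensorPower_le ν _
      _ = ν.strength * ‖blochVec (A.noisyState ν ρ₀ θ L)‖ := by
          rw [norm_blochVec_evolve (A.isHermitian_generator θ L)
            (A.isHermitian_noisyState ν hρ₀ θ L)]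
      _ ≤ ν.strength * (ν.strength ^ L * ‖blochVec ρ₀‖) :=
          mul_le_mul_of_nonneg_left ih ν.strength_nonneg
      _ = ν.strength ^ (L + 1) * ‖blochVec ρ₀‖ := by ring

lemma norm_blochVec_noisyState_sub_le {ρ₀ : Op n} (hρ₀ : ρ₀.IsHermitian) (θ θ' : A.Params)
    (L : ℕ) :
    ‖blochVec (A.noisyState ν ρ₀ θ' L - A.noisyState ν ρ₀ θ L)‖ ≤
      2 * (∑ j ∈ Finset.range L, pauliL1 (A.generator θ' j - A.generator θ j)) *
        (ν.strength ^ L * ‖blochVec ρ₀‖) := by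
  induction L with
  | zero => simp [noisyState]
  | succ L ih =>
    set ρ := A.noisyState ν ρ₀ θ L
    set ρ' := A.noisyState ν ρ₀ θ' L
    set G := A.generator θ L
    set G' := A.generator θ' L
    have hG : G.IsHermitian := A.isHermitian_generator θ L
    have hG' : G'.IsHermitian := A.isHermitian_generator θ' L
    have hρ : ρ.IsHermitian := A.isHermitian_noisyState ν hρ₀ θ L
    have hρ' : ρ'.IsHermitian := A.isHermitian_noisyState ν hρ₀ θ' L
    have split : evolve G' ρ' - evolve G ρ = evolve G' (ρ' - ρ) + (evolve G' ρ - evolve G ρ) := by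
      rw [evolve_sub]
      abel
    calc ‖blochVec (A.noisyState ν ρ₀ θ' (L + 1) - A.noisyState ν ρ₀ θ (L + 1))‖
        ≤ ν.strength * ‖blochVec (evolve G' ρ' - evolve G ρ)‖ := by
          rw [noisyState_succ, noisyState_succ, ← map_sub]
          exact norm_blochVec_tensorPower_le ν _
      _ ≤ ν.strength * (‖blochVec (ρ' - ρ)‖ + 2 * pauliL1 (G' - G) * ‖blochVec ρ‖) := by
          rw [split, map_add, ← norm_blochVec_evolve hG' (hρ'.sub hρ)]
          exact mul_le_mul_of_nonneg_left ((norm_add_le _ _).trans (add_le_add_right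
            (norm_blochVec_evolve_sub_evolve_le hG' hG hρ) _)) ν.strength_nonneg
      _ ≤ ν.strength * (2 * (∑ j ∈ Finset.range L,
            pauliL1 (A.generator θ' j - A.generator θ j)) * (ν.strength ^ L * ‖blochVec ρ₀‖) +
            2 * pauliL1 (G' - G) * (ν.strength ^ L * ‖blochVec ρ₀‖)) := by
          have := ν.strength_nonneg
          have := pauliL1_nonneg (G' - G)
          gcongr
          exact A.norm_blochVec_noisyState_le ν hρ₀ θ L
      _ = 2 * (∑ j ∈ Finset.range (L + 1), pauliL1 (A.generator θ' j - A.generator θ j)) *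
            (ν.strength ^ (L + 1) * ‖blochVec ρ₀‖) := by
          rw [Finset.sum_range_succ]
          ring

section Calculus

open scoped Matrix.Norms.Operator

lemma differentiableAt_noisyState (ρ₀ : Op n) (θ : A.Params) {l : ℕ} (m : Fin (A.numParams l))
    (t : ℝ) (L : ℕ) :
    DifferentiableAt ℝ (fun t => A.noisyState ν ρ₀ (A.setParam θ l m t) L) t := by
  induction L with
  | zero => exact differentiableAt_const ρ₀
  | succ L ih =>
    simp only [noisyState_succ, generator_setParam]
    refine (tensorPowerL ν.channel).differentiableAt.comp t (differentiableAt_evolve ?_ ih)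
    fun_prop

lemma exists_hasDerivAt_blochVec_noisyState {ρ₀ : Op n} (hρ₀ : ρ₀.IsHermitian) (θ : A.Params)
    {l : ℕ} (m : Fin (A.numParams l)) (L : ℕ) :
    ∃ r', HasDerivAt (fun t => blochVec (A.noisyState ν ρ₀ (A.setParam θ l m t) L)) r' (θ l m) ∧
      ‖r'‖ ≤ 2 * pauliL1 (A.H l m) * (ν.strength ^ L * ‖blochVec ρ₀‖) := by
  have hq := pow_nonneg ν.strength_nonneg L
  have hH := pauliL1_nonneg (A.H l m)
  have h := (blochVec.differentiableAt.comp (θ l m)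
    (A.differentiableAt_noisyState ν ρ₀ θ m (θ l m) L)).hasDerivAt
  refine ⟨_, h, h.le_of_lip' (by positivity) (.of_forall fun t => ?_)⟩
  have variation : ∑ j ∈ Finset.range L,
      pauliL1 (A.generator (A.setParam θ l m t) j - A.generator θ j) ≤
        |t - θ l m| * pauliL1 (A.H l m) := by
    simp only [generator_setParam, add_sub_cancel_left, pauliL1_smul, apply_ite pauliL1,
      pauliL1_zero, ← Finset.mul_sum, Finset.sum_ite_eq']
    gcongr
    split_ifs <;> simp [hH]
  simp only [Function.comp_apply, setParam_self, ← map_sub]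
  calc _ ≤ _ := A.norm_blochVec_noisyState_sub_le ν hρ₀ θ (A.setParam θ l m t) L
    _ ≤ 2 * (|t - θ l m| * pauliL1 (A.H l m)) * (ν.strength ^ L * ‖blochVec ρ₀‖) := by gcongr
    _ = _ := by rw [Real.norm_eq_abs]; ring

end Calculus

end Ansatz

/-! ### Scalar estimates -/

section ScalarEstimates

lemma mul_le_mul_sub_pow_four {d ε u : ℝ} (hd₀ : 0 ≤ d) (hd : d ^ 4 = 2) (hε : 0 < ε)
    (hu : u ≤ 1) (hdu : d * ε ≤ u) : d * ε * (1 + ε) ≤ u * ((1 + ε) ^ 2 - u ^ 4) := by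
  have one_le_d : 1 ≤ d := by
    by_contra! h
    linarith [pow_lt_one₀ hd₀ h four_ne_zero]
  have d_le : d ≤ 5 / 4 := by
    by_contra! h
    have := pow_lt_pow_left₀ h (by norm_num) four_ne_zero
    norm_num [hd] at this
  have ε_le : ε ≤ 1 := (le_mul_of_one_le_left hε.le one_le_d).trans (hdu.trans hu)
  -- The right-hand side is concave in `u`, so it suffices to look at the end points of `[d ε, 1]`.
  let f (u : ℝ) : ℝ := (1 + ε) ^ 2 * u - u ^ 5
  have concave : ConcaveOn ℝ (Set.Ici 0) f :=
    (LinearMap.mul ℝ ℝ ((1 + ε) ^ 2)).concaveOn (convex_Ici 0) |>.sub (convexOn_pow 5)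
  have at_left : d * ε * (1 + ε) ≤ f (d * ε) :=
    calc d * ε * (1 + ε) ≤ d * ε * ((1 + ε) ^ 2 - 2 * ε ^ 4) := by
          gcongr
          nlinarith [pow_le_of_le_one hε.le ε_le four_ne_zero,
            pow_le_pow_of_le_one hε.le ε_le (show 2 ≤ 4 by norm_num)]
      _ = f (d * ε) := by simp only [f, ← hd]; ring
  have at_right : d * ε * (1 + ε) ≤ f 1 := by
    simp only [f]
    nlinarith [mul_nonneg hε.le (sub_nonneg.mpr d_le), mul_pos hε hε]
  calc d * ε * (1 + ε) ≤ f u := (le_min at_left at_right).trans <|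
        concave.min_le_of_mem_Icc (Set.mem_Ici.mpr (by positivity)) (Set.mem_Ici.mpr zero_le_one)
          ⟨hdu, hu⟩
    _ = u * ((1 + ε) ^ 2 - u ^ 4) := by ring

lemma sqrt_two_mul_sq_le {q ε : ℝ} (hε : 0 < ε) (hq : q ≤ 1) (hεq : √2 * ε ^ 2 ≤ q) :
    √2 * ε ^ 2 * (1 + ε) ^ 2 ≤ q * ((1 + ε) ^ 2 - q ^ 2) ^ 2 := by
  set d := √√2
  set u := √q
  have d_sq : d ^ 2 = √2 := Real.sq_sqrt (Real.sqrt_nonneg 2)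
  have d_pow : d ^ 4 = 2 := by
    rw [show d ^ 4 = (d ^ 2) ^ 2 by ring, d_sq, Real.sq_sqrt zero_le_two]
  have u_sq : u ^ 2 = q := Real.sq_sqrt ((by positivity : 0 ≤ √2 * ε ^ 2).trans hεq)
  have root : d * ε * (1 + ε) ≤ u * ((1 + ε) ^ 2 - u ^ 4) :=
    mul_le_mul_sub_pow_four (Real.sqrt_nonneg _) d_pow hε (Real.sqrt_le_one.mpr hq)
      (Real.le_sqrt_of_sq_le (by rwa [mul_pow, d_sq]))
  calc √2 * ε ^ 2 * (1 + ε) ^ 2 = (d * ε * (1 + ε)) ^ 2 := by rw [← d_sq]; ring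
    _ ≤ (u * ((1 + ε) ^ 2 - u ^ 4)) ^ 2 := pow_le_pow_left₀ (by positivity) root 2
    _ = q * ((1 + ε) ^ 2 - q ^ 2) ^ 2 := by rw [← u_sq]; ring

variable {q ε k M a : ℝ} {L₀ L : ℕ}

lemma abs_mul_sq_le_of_depth (hq₀ : 0 ≤ q) (hq : q ≤ 1) (hε : 0 ≤ ε) (hM : 0 < M)
    (hkM : |k| ≤ M) (hL₀ : q ^ L₀ * M * (1 + ε) ≤ |k|) (hL : 2 * L₀ + 1 < L)
    (ha : |a| ≤ q ^ L * M) : |a| * (1 + ε) ^ 2 ≤ |k| * q ^ 2 := by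
  have pow_L₀_le : q ^ L₀ * (1 + ε) ≤ 1 :=
    le_of_mul_le_mul_right (by linarith) hM
  calc |a| * (1 + ε) ^ 2 ≤ q ^ (2 * L₀ + 2) * M * (1 + ε) ^ 2 := by
        gcongr
        exact ha.trans (mul_le_mul_of_nonneg_right (pow_le_pow_of_le_one hq₀ hq hL) hM.le)
    _ = q ^ L₀ * (1 + ε) * (q ^ L₀ * M * (1 + ε)) * q ^ 2 := by ring
    _ ≤ 1 * |k| * q ^ 2 := by gcongr
    _ = |k| * q ^ 2 := by rw [one_mul]

lemma abs_mul_le_abs_add (h : |a| * (1 + ε) ^ 2 ≤ |k| * q ^ 2) :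
    |k| * ((1 + ε) ^ 2 - q ^ 2) ≤ (1 + ε) ^ 2 * |k + a| := by
  linarith [mul_le_mul_of_nonneg_left (abs_sub_abs_le_abs_add k a) (sq_nonneg (1 + ε))]

lemma add_ne_zero_of_abs_mul_le (hq₀ : 0 ≤ q) (hq : q ≤ 1) (hε : 0 < ε) (hk : k ≠ 0)
    (h : |a| * (1 + ε) ^ 2 ≤ |k| * q ^ 2) : k + a ≠ 0 := by
  have gap : 0 < (1 + ε) ^ 2 - q ^ 2 := by nlinarith
  have : 0 < (1 + ε) ^ 2 * |k + a| :=
    (mul_pos (abs_pos.mpr hk) gap).trans_le (abs_mul_le_abs_add h)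
  exact abs_pos.mp (pos_of_mul_pos_right this (sq_nonneg _))

lemma sq_mul_sq_le_of_depth (hq₀ : 0 < q) (hq : q ≤ 1) (hε : 0 ≤ ε) (hM : 0 < M)
    (hL₀ : q ^ L₀ * M * (1 + ε) ≤ |k|) (hL : 2 * L₀ + 1 < L) (ha : |a| ≤ q ^ L * M) :
    (|k| / (q ^ L₀ * M) - q ^ (L₀ + 1)) ^ 2 * a ^ 2 ≤ q ^ (L + 1) * (k + a) ^ 2 := by
  set z := q ^ (L - L₀)
  have z_le : z ≤ q ^ (L₀ + 1) := pow_le_pow_of_le_one hq₀.le hq (by omega)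
  have z_sq_le : z ^ 2 ≤ q ^ (L + 1) := by
    rw [← pow_mul]
    exact pow_le_pow_of_le_one hq₀.le hq (by omega)
  have factor_nonneg : 0 ≤ |k| / (q ^ L₀ * M) - q ^ (L₀ + 1) := by
    have : 1 ≤ |k| / (q ^ L₀ * M) := by
      rw [one_le_div (by positivity)]
      exact (le_mul_of_one_le_right (by positivity) (by linarith)).trans hL₀
    linarith [pow_le_one₀ hq₀.le hq (n := L₀ + 1)]
  have scaled : |a| * (|k| / (q ^ L₀ * M)) ≤ z * |k| := by
    rw [← mul_div_assoc, div_le_iff₀ (by positivity)]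
    calc |a| * |k| ≤ q ^ L * M * |k| := by gcongr
      _ = z * |k| * (q ^ L₀ * M) := by rw [← pow_sub_mul_pow q (show L₀ ≤ L by omega)]; ring
  have root : (|k| / (q ^ L₀ * M) - q ^ (L₀ + 1)) * |a| ≤ z * |k + a| :=
    calc (|k| / (q ^ L₀ * M) - q ^ (L₀ + 1)) * |a| ≤ z * |k| - z * |a| := by
          linarith [mul_le_mul_of_nonneg_right z_le (abs_nonneg a)]
      _ = z * (|k| - |a|) := by ring
      _ ≤ z * |k + a| := mul_le_mul_of_nonneg_left (abs_sub_abs_le_abs_add k a) (by positivity)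
  calc (|k| / (q ^ L₀ * M) - q ^ (L₀ + 1)) ^ 2 * a ^ 2
      = ((|k| / (q ^ L₀ * M) - q ^ (L₀ + 1)) * |a|) ^ 2 := by rw [mul_pow, sq_abs]
    _ ≤ (z * |k + a|) ^ 2 := pow_le_pow_left₀ (by positivity) root 2
    _ = z ^ 2 * (k + a) ^ 2 := by rw [mul_pow, sq_abs]
    _ ≤ q ^ (L + 1) * (k + a) ^ 2 := by gcongr

lemma sqrt_two_mul_sq_mul_sq_le (hε : 0 < ε) (hq : q ≤ 1) (hεq : √2 * ε ^ 2 ≤ q)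
    (h : |a| * (1 + ε) ^ 2 ≤ |k| * q ^ 2) :
    √2 * (ε ^ 2 * k ^ 2) ≤ q * (1 + ε) ^ 2 * (k + a) ^ 2 := by
  have hq₀ : 0 ≤ q := le_trans (by positivity) hεq
  have gap : 0 ≤ (1 + ε) ^ 2 - q ^ 2 := by nlinarith
  refine le_of_mul_le_mul_right ?_ (by positivity : 0 < (1 + ε) ^ 2)
  calc √2 * (ε ^ 2 * k ^ 2) * (1 + ε) ^ 2 = k ^ 2 * (√2 * ε ^ 2 * (1 + ε) ^ 2) := by ring
    _ ≤ k ^ 2 * (q * ((1 + ε) ^ 2 - q ^ 2) ^ 2) :=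
        mul_le_mul_of_nonneg_left (sqrt_two_mul_sq_le hε hq hεq) (sq_nonneg k)
    _ = q * (|k| * ((1 + ε) ^ 2 - q ^ 2)) ^ 2 := by rw [mul_pow |k|, sq_abs]; ring
    _ ≤ q * ((1 + ε) ^ 2 * |k + a|) ^ 2 :=
        mul_le_mul_of_nonneg_left (pow_le_pow_left₀ (by positivity) (abs_mul_le_abs_add h) 2) hq₀
    _ = q * (1 + ε) ^ 2 * (k + a) ^ 2 * (1 + ε) ^ 2 := by rw [mul_pow, sq_abs]; ring

lemma div_mul_le_of_depth {B D : ℝ} (hε : 0 < ε) (hq : q ≤ 1) (hεq : √2 * ε ^ 2 ≤ q)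
    (h : |a| * (1 + ε) ^ 2 ≤ |k| * q ^ 2) (hB : 0 ≤ B) (hD : D ≤ √2 * q ^ L * B) :
    ε ^ 2 * k ^ 2 / ((1 + ε) ^ 2 * B) * D ≤ q ^ (L + 1) * (k + a) ^ 2 := by
  have hq₀ : 0 ≤ q := le_trans (by positivity) hεq
  rcases hB.eq_or_lt with rfl | hB
  · rw [mul_zero, div_zero, zero_mul]
    positivity
  calc ε ^ 2 * k ^ 2 / ((1 + ε) ^ 2 * B) * D
      ≤ ε ^ 2 * k ^ 2 / ((1 + ε) ^ 2 * B) * (√2 * q ^ L * B) := by gcongr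
    _ = q ^ L / (1 + ε) ^ 2 * (√2 * (ε ^ 2 * k ^ 2)) := by field_simp
    _ ≤ q ^ L / (1 + ε) ^ 2 * (q * (1 + ε) ^ 2 * (k + a) ^ 2) :=
        mul_le_mul_of_nonneg_left (sqrt_two_mul_sq_mul_sq_le hε hq hεq h) (by positivity)
    _ = q ^ (L + 1) * (k + a) ^ 2 := by field_simp; ring

lemma div_mul_abs_sub_one_le {s Q x a c₁ c₂ D : ℝ} (hs : 0 ≤ s) (hQ : 0 < Q) (hx : x ≠ 0)
    (hc : x ^ 2 * c₁ = a ^ 2 * c₂ + D) (ha : s * a ^ 2 ≤ Q * x ^ 2) (hD : s * |D| ≤ Q * x ^ 2) :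
    s / Q * |c₁| - 1 ≤ |c₂| := by
  have triangle : x ^ 2 * |c₁| ≤ a ^ 2 * |c₂| + |D| := by
    calc x ^ 2 * |c₁| = |a ^ 2 * c₂ + D| := by rw [← hc, abs_mul, abs_of_nonneg (sq_nonneg x)]
      _ ≤ |a ^ 2 * c₂| + |D| := abs_add_le _ _
      _ = a ^ 2 * |c₂| + |D| := by rw [abs_mul, abs_of_nonneg (sq_nonneg a)]
  have scaled : x ^ 2 * (s * |c₁|) ≤ x ^ 2 * ((|c₂| + 1) * Q) := by
    calc x ^ 2 * (s * |c₁|) = s * (x ^ 2 * |c₁|) := by ring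
      _ ≤ s * (a ^ 2 * |c₂| + |D|) := by gcongr
      _ = s * a ^ 2 * |c₂| + s * |D| := by ring
      _ ≤ Q * x ^ 2 * |c₂| + Q * x ^ 2 := by gcongr
      _ = x ^ 2 * ((|c₂| + 1) * Q) := by ring
  rw [sub_le_iff_le_add, div_mul_eq_mul_div, div_le_iff₀ hQ]
  exact le_of_mul_le_mul_left scaled (by positivity)

end ScalarEstimates

/-! ### The cost functions -/

namespace TruncatedObservable

variable (T : TruncatedObservable n)

lemma isHermitian_proj (i : Bits n) : (T.proj i).IsHermitian := by
  rw [Matrix.IsHermitian, proj, Matrix.conjTranspose_vecMulVec, star_star]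

lemma star_dotProduct_eigenbasis (i j : Bits n) :
    star (WithLp.ofLp (T.eigenbasis i)) ⬝ᵥ WithLp.ofLp (T.eigenbasis j) =
      if i = j then 1 else 0 := by
  rw [dotProduct_comm, ← EuclideanSpace.inner_eq_star_dotProduct]
  exact orthonormal_iff_ite.mp T.eigenbasis.orthonormal i j

lemma proj_mul_proj (i j : Bits n) : T.proj i * T.proj j = if i = j then T.proj i else 0 := by
  rw [proj, proj, Matrix.vecMulVec_mul_vecMulVec, star_dotProduct_eigenbasis]
  split_ifs with h
  · simp only [h, one_smul]
  · rw [zero_smul, Matrix.vecMulVec_zero]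

lemma trace_proj (i : Bits n) : (T.proj i).trace = 1 := by
  rw [proj, Matrix.trace_vecMulVec, dotProduct_comm, star_dotProduct_eigenbasis, if_pos rfl]

lemma prob_eq (ρ : Op n) (i : Bits n) : T.prob ρ i = (ρ * T.proj i).trace.re := by
  rw [prob, proj, Matrix.mul_vecMulVec, Matrix.trace_vecMulVec, dotProduct_comm]

lemma isHermitian_O₁ : T.O₁.IsHermitian :=
  isSelfAdjoint_sum _ fun i _ => (T.isHermitian_proj i).smul (Complex.conj_ofReal _)

lemma isHermitian_O₂ : T.O₂.IsHermitian := isSelfAdjoint_sum _ fun i _ => T.isHermitian_proj i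

lemma O₂_mul_O₂ : T.O₂ * T.O₂ = T.O₂ := by
  simp only [O₂, Finset.sum_mul_sum, proj_mul_proj]
  exact Finset.sum_congr rfl fun i hi => by rw [Finset.sum_ite_eq, if_pos hi]

lemma trace_O₂ : T.O₂.trace = T.S.card := by
  simp only [O₂, Matrix.trace_sum, trace_proj, Finset.sum_const, nsmul_one]

lemma norm_w₂_sq : ‖T.w₂‖ ^ 2 = T.k₂ * (1 - T.k₂) := by
  rw [w₂, k₂, pauliVec_eq_smul_blochVec, norm_smul, mul_pow, norm_blochVec_sq T.isHermitian_O₂,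
    O₂_mul_O₂, identityCoeff, Real.norm_eq_abs, sq_abs]
  field_simp

lemma abs_k₂_le (hw₂ : T.w₂ ≠ 0) : |T.k₂| ≤ √(2 ^ n - 1) * ‖T.w₂‖ := by
  have k₂_eq : 2 ^ n * T.k₂ = T.S.card := by
    rw [k₂, identityCoeff, trace_O₂, Complex.natCast_re]
    field_simp
  have k₂_nonneg : 0 ≤ T.k₂ := nonneg_of_mul_nonneg_right (k₂_eq ▸ Nat.cast_nonneg _)
    (by positivity)
  have w₂_pos : 0 < T.k₂ * (1 - T.k₂) := T.norm_w₂_sq ▸ by positivity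
  have k₂_lt : T.k₂ < 1 := sub_pos.mp (pos_of_mul_pos_right w₂_pos k₂_nonneg)
  have card_lt : (T.S.card : ℝ) < 2 ^ n := by
    rw [← k₂_eq]
    exact mul_lt_of_lt_one_right (by positivity) k₂_lt
  have card_le : (T.S.card : ℝ) ≤ 2 ^ n - 1 := by
    have : T.S.card + 1 ≤ 2 ^ n := by exact_mod_cast card_lt
    rw [le_sub_iff_add_le]
    exact_mod_cast this
  refine abs_le_of_sq_le_sq' ?_ (by positivity) |> abs_le.mpr
  have one_le : (1 : ℝ) ≤ 2 ^ n := one_le_pow₀ one_le_two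
  rw [mul_pow, Real.sq_sqrt (sub_nonneg.mpr one_le), norm_w₂_sq]
  rw [← k₂_eq] at card_le
  nlinarith

lemma trace_mul_traceless {M ρ : Op n} (hM : M.IsHermitian) (hρ : ρ.IsHermitian)
    (htr : ρ.trace = 1) :
    (ρ * (M - (M.trace / 2 ^ n) • (1 : Op n))).trace =
      (inner ℝ (blochVec ρ) (pauliVec M) : ℝ) := by
  have h := re_trace_mul_eq hρ hM
  rw [htr, Complex.one_re, one_mul, identityCoeff, ← sub_eq_iff_eq_add'] at h
  rw [← h, mul_sub, Matrix.trace_sub, Matrix.mul_smul, mul_one, Matrix.trace_smul, htr]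
  push_cast
  rw [ofReal_re_trace_mul hρ hM, ofReal_re_trace hM, smul_eq_mul, mul_one]

lemma trace_mul_O₂' {ρ : Op n} (hρ : ρ.IsHermitian) (htr : ρ.trace = 1) :
    (ρ * T.O₂').trace = (inner ℝ (blochVec ρ) T.w₂ : ℝ) :=
  trace_mul_traceless T.isHermitian_O₂ hρ htr

lemma C₂_eq {ρ : Op n} (hρ : ρ.IsHermitian) (htr : ρ.trace = 1) :
    T.C₂ ρ = inner ℝ (blochVec ρ) T.w₁ / inner ℝ (blochVec ρ) T.w₂ := by
  rw [C₂, trace_mul_O₂' T hρ htr, O₁', trace_mul_traceless T.isHermitian_O₁ hρ htr]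
  rfl

lemma C₁_eq {ρ : Op n} (hρ : ρ.IsHermitian) (htr : ρ.trace = 1) :
    T.C₁ ρ = (T.k₁ + inner ℝ (blochVec ρ) T.w₁) / (T.k₂ + inner ℝ (blochVec ρ) T.w₂) := by
  have expectation {M : Op n} (hM : M.IsHermitian) :
      identityCoeff M + inner ℝ (blochVec ρ) (pauliVec M) = (ρ * M).trace.re := by
    rw [re_trace_mul_eq hρ hM, htr, Complex.one_re, one_mul]
  rw [k₁, k₂, w₁, w₂, expectation T.isHermitian_O₁, expectation T.isHermitian_O₂, C₁]
  simp only [prob_eq, O₁, O₂, Finset.mul_sum, Matrix.trace_sum, Complex.re_sum, Matrix.mul_smul,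
    Matrix.trace_smul, smul_eq_mul, Complex.re_ofReal_mul]

lemma exists_hasDerivAt_costs {ρ : ℝ → Op n} {r' : EuclideanSpace ℝ (NontrivialString n)} {t : ℝ}
    (hρ : ∀ t, (ρ t).IsHermitian) (htr : ∀ t, (ρ t).trace = 1)
    (hr : HasDerivAt (fun t => blochVec (ρ t)) r' t)
    (h₁ : T.k₂ + inner ℝ (blochVec (ρ t)) T.w₂ ≠ 0) (h₂ : inner ℝ (blochVec (ρ t)) T.w₂ ≠ 0) :
    ∃ c₁ c₂, HasDerivAt (fun t => T.C₁ (ρ t)) c₁ t ∧ HasDerivAt (fun t => T.C₂ (ρ t)) c₂ t ∧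
      (T.k₂ + inner ℝ (blochVec (ρ t)) T.w₂) ^ 2 * c₁ =
        inner ℝ (blochVec (ρ t)) T.w₂ ^ 2 * c₂ + inner ℝ r' (T.k₂ • T.w₁ - T.k₁ • T.w₂) := by
  have inner_deriv (w) :
      HasDerivAt (fun t => inner ℝ (blochVec (ρ t)) w) (inner ℝ r' w) t := by
    simpa using hr.inner ℝ (hasDerivAt_const t w)
  simp only [fun t => T.C₁_eq (hρ t) (htr t), fun t => T.C₂_eq (hρ t) (htr t)]
  refine ⟨_, _, ((inner_deriv _).const_add _).fun_div ((inner_deriv _).const_add _) h₁,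
    (inner_deriv _).fun_div (inner_deriv _) h₂, ?_⟩
  rw [mul_div_cancel₀ _ (pow_ne_zero 2 h₁), mul_div_cancel₀ _ (pow_ne_zero 2 h₂),
    inner_sub_right, real_inner_smul_right, real_inner_smul_right]
  ring

lemma s_nonneg (q ε : ℝ) (L₀ : ℕ) (H : Op n) : 0 ≤ T.s q ε L₀ H := by
  have : 0 ≤ maxNorm (pauliVec H) := norm_nonneg _
  exact le_min (by positivity) (sq_nonneg _)

section Bounds

variable {q ε : ℝ} {L₀ L : ℕ} {r r' : EuclideanSpace ℝ (NontrivialString n)}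

lemma abs_inner_w₂_le (hr : ‖r‖ ≤ q ^ L * √(2 ^ n - 1)) :
    |inner ℝ r T.w₂| ≤ q ^ L * (√(2 ^ n - 1) * ‖T.w₂‖) := by
  rw [← mul_assoc]
  exact (abs_real_inner_le_norm _ _).trans (mul_le_mul_of_nonneg_right hr (norm_nonneg _))

lemma s_mul_sq_inner_le (hq₀ : 0 < q) (hq : q ≤ 1) (hε : 0 ≤ ε)
    (hM : 0 < √(2 ^ n - 1) * ‖T.w₂‖) (hL₀ : q ^ L₀ * √(2 ^ n - 1) * ‖T.w₂‖ * (1 + ε) ≤ |T.k₂|)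
    (hL : 2 * L₀ + 1 < L) (hr : ‖r‖ ≤ q ^ L * √(2 ^ n - 1)) (H : Op n) :
    T.s q ε L₀ H * inner ℝ r T.w₂ ^ 2 ≤ q ^ (L + 1) * (T.k₂ + inner ℝ r T.w₂) ^ 2 := by
  rw [mul_assoc (q ^ L₀)] at hL₀
  refine le_trans ?_ (sq_mul_sq_le_of_depth hq₀ hq hε hM hL₀ hL (T.abs_inner_w₂_le hr))
  rw [← mul_assoc]
  exact mul_le_mul_of_nonneg_right (min_le_right _ _) (sq_nonneg _)

lemma s_mul_abs_inner_le (hε : 0 < ε) (hq : q ≤ 1) (hεq : √2 * ε ^ 2 ≤ q) {a : ℝ}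
    (ha : |a| * (1 + ε) ^ 2 ≤ |T.k₂| * q ^ 2) {H : Op n}
    (hr' : ‖r'‖ ≤ 2 * pauliL1 H * (q ^ L * √(2 ^ n - 1))) :
    T.s q ε L₀ H * |inner ℝ r' (T.k₂ • T.w₁ - T.k₁ • T.w₂)| ≤ q ^ (L + 1) * (T.k₂ + a) ^ 2 := by
  have hq₀ : 0 ≤ q := (by positivity : 0 ≤ √2 * ε ^ 2).trans hεq
  set W := T.k₂ • T.w₁ - T.k₁ • T.w₂
  set η := pauliVec H
  have η_nonneg : 0 ≤ maxNorm η := norm_nonneg _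
  have sqrt_eq : √(2 ^ (n + 1) - 2 : ℝ) = √2 * √(2 ^ n - 1) := by
    rw [← Real.sqrt_mul zero_le_two]
    ring_nf
  set B := √(2 ^ (n + 1) - 2) * numNonzero η * maxNorm η * ‖W‖
  have inner_le : |inner ℝ r' W| ≤ √2 * q ^ L * B :=
    calc |inner ℝ r' W| ≤ ‖r'‖ * ‖W‖ := abs_real_inner_le_norm _ _
      _ ≤ 2 * (numNonzero η * maxNorm η) * (q ^ L * √(2 ^ n - 1)) * ‖W‖ := by
          grw [hr', pauliL1_le]
      _ = (√2 * √2) * (numNonzero η * maxNorm η) * (q ^ L * √(2 ^ n - 1)) * ‖W‖ := by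
          rw [Real.mul_self_sqrt zero_le_two]
      _ = √2 * q ^ L * B := by simp only [B, sqrt_eq]; ring
  refine le_trans ?_ (div_mul_le_of_depth hε hq hεq ha (by positivity) inner_le)
  refine mul_le_mul_of_nonneg_right ((min_le_left _ _).trans_eq ?_) (abs_nonneg _)
  simp only [B, mul_assoc, η, W]

theorem gradient_bound {ρ : ℝ → Op n} {t : ℝ} (hρ : ∀ t, (ρ t).IsHermitian)
    (htr : ∀ t, (ρ t).trace = 1) (hε : 0 < ε) (hq : q ≤ 1) (hεq : √2 * ε ^ 2 ≤ q)
    (hL₀ : q ^ L₀ * √(2 ^ n - 1) * ‖T.w₂‖ * (1 + ε) ≤ |T.k₂|) (hL : 2 * L₀ + 1 < L)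
    (hr : ‖blochVec (ρ t)‖ ≤ q ^ L * √(2 ^ n - 1))
    (hr' : HasDerivAt (fun t => blochVec (ρ t)) r' t) {H : Op n}
    (hr'_le : ‖r'‖ ≤ 2 * pauliL1 H * (q ^ L * √(2 ^ n - 1))) (hC₂ : (ρ t * T.O₂').trace ≠ 0) :
    DifferentiableAt ℝ (fun t => T.C₁ (ρ t)) t ∧ DifferentiableAt ℝ (fun t => T.C₂ (ρ t)) t ∧
      T.s q ε L₀ H / q ^ (L + 1) * |deriv (fun t => T.C₁ (ρ t)) t| - 1 ≤
        |deriv (fun t => T.C₂ (ρ t)) t| := by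
  have hq₀ : 0 < q := (by positivity : 0 < √2 * ε ^ 2).trans_le hεq
  have a_ne : inner ℝ (blochVec (ρ t)) T.w₂ ≠ 0 := by
    rwa [T.trace_mul_O₂' (hρ t) (htr t), Complex.ofReal_ne_zero] at hC₂
  have a_le := T.abs_inner_w₂_le hr
  have w₂_ne : T.w₂ ≠ 0 := fun h => a_ne (by rw [h, inner_zero_right])
  have M_pos : 0 < √(2 ^ n - 1) * ‖T.w₂‖ :=
    pos_of_mul_pos_right ((abs_pos.mpr a_ne).trans_le a_le) (by positivity)
  have hL₀' : q ^ L₀ * (√(2 ^ n - 1) * ‖T.w₂‖) * (1 + ε) ≤ |T.k₂| := by rwa [← mul_assoc]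
  have k_ne : T.k₂ ≠ 0 := abs_pos.mp (lt_of_lt_of_le (by positivity) hL₀')
  have a_small := abs_mul_sq_le_of_depth hq₀.le hq hε.le M_pos (T.abs_k₂_le w₂_ne) hL₀' hL a_le
  have den_ne := add_ne_zero_of_abs_mul_le hq₀.le hq hε k_ne a_small
  obtain ⟨c₁, c₂, hc₁, hc₂, hc⟩ := T.exists_hasDerivAt_costs hρ htr hr' den_ne a_ne
  refine ⟨hc₁.differentiableAt, hc₂.differentiableAt, ?_⟩
  rw [hc₁.deriv, hc₂.deriv]
  exact div_mul_abs_sub_one_le (T.s_nonneg ..) (by positivity) den_ne hc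
    (T.s_mul_sq_inner_le hq₀ hq hε.le M_pos hL₀ hL hr H)
    (T.s_mul_abs_inner_le hε hq hεq a_small hr'_le)

end Bounds

end TruncatedObservable

end NoisyVQA

end

theorem theorem3p1_general {n : ℕ} (ν : NoisyVQA.PauliNoise) (A : NoisyVQA.Ansatz n)
    (ρ₀ : NoisyVQA.Op n) (hρ₀ : NoisyVQA.IsDensity ρ₀) (T : NoisyVQA.TruncatedObservable n)
    (ε : ℝ) (hε : 0 < ε) (hεq : √2 * ε ^ 2 ≤ ν.strength)
    (L₀ : ℕ) (hL₀ : ν.strength ^ L₀ * √(2 ^ n - 1) * ‖T.w₂‖ * (1 + ε) ≤ |T.k₂|)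
    (L : ℕ) (hL : 2 * L₀ + 1 < L)
    (l : ℕ) (m : Fin (A.numParams l)) (θ : A.Params)
    (hC₂ : (A.noisyState ν ρ₀ θ L * T.O₂').trace ≠ 0) :
    DifferentiableAt ℝ (fun t => T.C₁ (A.noisyState ν ρ₀ (A.setParam θ l m t) L)) (θ l m) ∧
    DifferentiableAt ℝ (fun t => T.C₂ (A.noisyState ν ρ₀ (A.setParam θ l m t) L)) (θ l m) ∧
    |deriv (fun t => T.C₂ (A.noisyState ν ρ₀ (A.setParam θ l m t) L)) (θ l m)| ≥
      T.s ν.strength ε L₀ (A.H l m) / ν.strength ^ (L + 1) *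
        |deriv (fun t => T.C₁ (A.noisyState ν ρ₀ (A.setParam θ l m t) L)) (θ l m)| - 1 := by
  have hherm := hρ₀.1.isHermitian
  have hq := pow_nonneg ν.strength_nonneg L
  have hH := NoisyVQA.pauliL1_nonneg (A.H l m)
  obtain ⟨r', hr', r'_le⟩ := A.exists_hasDerivAt_blochVec_noisyState ν hherm θ m L
  have r_le := A.norm_blochVec_noisyState_le ν hherm θ L
  grw [hρ₀.norm_blochVec_le] at r_le r'_le
  exact T.gradient_bound (fun _ => A.isHermitian_noisyState ν hherm _ L)
    (fun _ => (A.trace_noisyState ν ρ₀ _ L).trans hρ₀.2) hε ν.strength_le_one hεq hL₀ hL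
    (by rwa [A.setParam_self]) hr' r'_le (by rwa [A.setParam_self])

theorem theorem3p1 {n : ℕ} (ν : NoisyVQA.PauliNoise) (A : NoisyVQA.Ansatz n)
    (ρ₀ : NoisyVQA.Op n) (hρ₀ : NoisyVQA.IsDensity ρ₀) (T : NoisyVQA.TruncatedObservable n)
    (ε : ℝ) (hε : 0 < ε) (hεq : √2 * ε ^ 2 ≤ ν.strength)
    (L₀ : ℕ)
    (hL₀ : IsLeast {m : ℕ | ν.strength ^ m * √(2 ^ n - 1) * ‖T.w₂‖ * (1 + ε) ≤ |T.k₂|} L₀)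
    (L : ℕ) (hL : 2 * L₀ + 1 < L)
    (l : ℕ) (hl : l < L) (m : Fin (A.numParams l)) (θ : A.Params)
    (hC₂ : (A.noisyState ν ρ₀ θ L * T.O₂').trace ≠ 0) :
    DifferentiableAt ℝ (fun t => T.C₁ (A.noisyState ν ρ₀ (A.setParam θ l m t) L)) (θ l m) ∧
    DifferentiableAt ℝ (fun t => T.C₂ (A.noisyState ν ρ₀ (A.setParam θ l m t) L)) (θ l m) ∧
    |deriv (fun t => T.C₂ (A.noisyState ν ρ₀ (A.setParam θ l m t) L)) (θ l m)| ≥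
      T.s ν.strength ε L₀ (A.H l m) / ν.strength ^ (L + 1) *
        |deriv (fun t => T.C₁ (A.noisyState ν ρ₀ (A.setParam θ l m t) L)) (θ l m)| - 1 :=
  theorem3p1_general ν A ρ₀ hρ₀ T ε hε hεq L₀ hL₀.1 L hL l m θ hC₂
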